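/- Let $G$ be a finite group. For an irreducible complex character $\chi$ of $G$, let $\ker\chi=\{g\in G:\chi(g)=\chi(1)\}$, and let the codegree of $\chi$ be $$a(\chi)=\frac{|G:\ker\chi|}{\chi(1)}.$$ If for every irreducible complex character $\chi$ of $G$ the codegree $a(\chi)$ is a prime power (that is, $a(\chi)=p^k$ for some prime $p$ and some integer $k\ge 0$, where $p$ and $k$ may depend on $\chi$), then $G$ is solvable. -/

import Mathlib

namespace CharCodegree

/-- The set `Irr(G)` of irreducible complex characters of `G`: the traces of the irreducible
finite-dimensional complex representations of `G`. (Every such representation is isomorphic to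
one on some `ℂⁿ`.) -/
def Irr (G : Type*) [Group G] : Set (G → ℂ) :=
  {χ | ∃ (n : ℕ) (ρ : Representation ℂ G (Fin n → ℂ)), ρ.IsIrreducible ∧ ρ.character = χ}

/-- A linear map of finite order on `ℂⁿ` whose trace is `n` is the identity. -/
theorem eq_one_of_trace_eq {n m : ℕ} (hm : m ≠ 0) (f : Module.End ℂ (Fin n → ℂ))
    (hf : f ^ m = 1) (ht : LinearMap.trace ℂ _ f = n) : f = 1 := by
  have hdvd : minpoly ℂ f ∣ Polynomial.X ^ m - 1 := minpoly.dvd _ _ (by simp [hf])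
  have hsq : Squarefree (minpoly ℂ f) := by
    refine Squarefree.squarefree_of_dvd hdvd (Polynomial.Separable.squarefree ?_)
    have := (Polynomial.separable_X_pow_sub_C (F := ℂ) (n := m) 1 (by exact_mod_cast hm) one_ne_zero)
    simpa using this
  have hsplit : f.charpoly.Splits := IsAlgClosed.splits _
  have hcard : f.charpoly.roots.card = n := by
    rw [← hsplit.natDegree_eq_card_roots, LinearMap.charpoly_natDegree]; simp
  have htr : f.charpoly.roots.sum = n := by
    rw [← ht, Module.End.trace_eq_sum_roots_charpoly_of_splits hsplit]
  have hnorm : ∀ z ∈ f.charpoly.roots, ‖z‖ = 1 := by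
    intro z hz
    have hz1 : f.charpoly.IsRoot z := Polynomial.isRoot_of_mem_roots hz
    have hz2 : (minpoly ℂ f).IsRoot z :=
      Module.End.isRoot_of_hasEigenvalue ((f.hasEigenvalue_iff_isRoot_charpoly z).2 hz1)
    have hz3 := hz2.dvd hdvd
    have hz4 : z ^ m = 1 := by simpa [sub_eq_zero] using hz3
    exact Complex.norm_eq_one_of_pow_eq_one hz4 hm
  have hone : ∀ z ∈ f.charpoly.roots, z = 1 := by
    have key : ∀ s : Multiset ℂ, (∀ z ∈ s, ‖z‖ = 1) →
        s.sum.re ≤ s.card ∧ (s.sum.re = s.card → ∀ z ∈ s, z = 1) := by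
      intro s
      induction s using Multiset.induction_on with
      | empty => simp
      | cons a s ih =>
        intro h
        obtain ⟨h1, h2⟩ := ih fun z hz => h z (Multiset.mem_cons_of_mem hz)
        have ha : ‖a‖ = 1 := h a (Multiset.mem_cons_self a s)
        have ha' : a.re ≤ 1 := ha ▸ Complex.re_le_norm a
        simp only [Multiset.sum_cons, Complex.add_re, Multiset.card_cons, Nat.cast_add,
          Nat.cast_one, Multiset.mem_cons, forall_eq_or_imp]
        refine ⟨by linarith, fun h3 => ⟨?_, h2 (by linarith)⟩⟩
        have ha1 : a.re = 1 := by linarith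
        have := Complex.sq_norm a
        rw [ha, Complex.normSq_apply, ha1] at this
        refine Complex.ext (by simpa using ha1) ?_
        have h0 : a.im * a.im = 0 := by linarith
        simpa using h0
    refine (key _ hnorm).2 ?_
    rw [htr, hcard]; simp
  have hchar : f.charpoly = (Polynomial.X - Polynomial.C 1) ^ n := by
    rw [hsplit.eq_prod_roots_of_monic f.charpoly_monic, Multiset.eq_replicate_of_mem hone, hcard]
    simp
  have hmin : minpoly ℂ f ∣ Polynomial.X - Polynomial.C 1 :=
    hsq.isRadical n _ (hchar ▸ LinearMap.minpoly_dvd_charpoly f)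
  have h0 : Polynomial.aeval f (Polynomial.X - Polynomial.C (1 : ℂ)) = 0 :=
    Polynomial.aeval_eq_zero_of_dvd_aeval_eq_zero hmin (minpoly.aeval _ _)
  simpa [sub_eq_zero] using h0

theorem character_eq_iff {G : Type*} [Group G] [Finite G] {n : ℕ}
    (ρ : Representation ℂ G (Fin n → ℂ)) (g : G) :
    ρ.character g = ρ.character 1 ↔ ρ g = 1 := by
  constructor
  · intro h
    refine eq_one_of_trace_eq (Nat.card_pos (α := G)).ne' _ ?_ ?_
    · rw [← map_pow, pow_card_eq_one', map_one]
    · rw [Representation.char_one] at h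
      simpa [Representation.character] using h
  · intro h
    simp [Representation.character, h]

/-- The kernel `ker χ = {g ∈ G | χ(g) = χ(1)}` of an irreducible character. -/
def charKer {G : Type*} [Group G] [Finite G] (χ : Irr G) : Subgroup G where
  carrier := {g | χ.1 g = χ.1 1}
  one_mem' := rfl
  mul_mem' := by
    obtain ⟨_, n, ρ, -, rfl⟩ := χ
    intro a b ha hb
    simp only [Set.mem_ofPred_eq, character_eq_iff] at ha hb ⊢
    rw [map_mul, ha, hb, one_mul]
  inv_mem' := by
    obtain ⟨_, n, ρ, -, rfl⟩ := χ
    intro a ha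
    simp only [Set.mem_ofPred_eq, character_eq_iff] at ha ⊢
    have h : ρ a⁻¹ * ρ a = 1 := by rw [← map_mul, inv_mul_cancel, map_one]
    rwa [ha, mul_one] at h

/-- The codegree `a(χ) = |G : ker χ| / χ(1)` of an irreducible character, as a complex number
(the quotient is the exact one, with no rounding; `χ(1)` is a positive integer). -/
noncomputable def codegree {G : Type*} [Group G] [Finite G] (χ : Irr G) : ℂ :=
  ((charKer χ).index : ℂ) / χ.1 1

/-- `z` is a prime power `p ^ k` with `p` prime and `k ≥ 0`. The value `1` is a prime power, as it
has to be: it is the codegree of the principal character. -/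
def IsPrimePower (z : ℂ) : Prop :=
  ∃ p k : ℕ, p.Prime ∧ z = (p : ℂ) ^ k

end CharCodegree

/-! Induct on `|G|`. The hypothesis passes to quotients, so every proper quotient is solvable, and
the solvable residual `N` lies in every nontrivial normal subgroup. An irreducible character
nontrivial on `N` is then faithful, so its degree `d` satisfies `|G| = d * p ^ k`. By Wedderburn,
the squares of these degrees sum to `|G : N| (|N| - 1)`. Divisibility by `q` shows that each prime
`q` dividing `|N|` occurs as such a `p`, and the bound `d ^ 2 ≤ |G|` excludes two distinct primes.
Hence `N` is a `p`-group, and `G` is solvable. -/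

namespace CharCodegree

open scoped MonoidAlgebra

/-! ### Wedderburn decomposition and sums of squared degrees -/

section Wedderburn

variable {G : Type*} [Group G]

/-- The representation of `G` on `ℂᵈ` given by an algebra homomorphism to `d × d` matrices. -/
noncomputable def matrixRep {d : ℕ} (f : ℂ[G] →ₐ[ℂ] Matrix (Fin d) (Fin d) ℂ) :
    Representation ℂ G (Fin d → ℂ) :=
  ((Matrix.toLinAlgEquiv' (R := ℂ) (n := Fin d)).toAlgHom.comp f : ℂ[G] →* _).comp
    (MonoidAlgebra.of ℂ G)

theorem matrixRep_apply {d : ℕ} (f : ℂ[G] →ₐ[ℂ] Matrix (Fin d) (Fin d) ℂ) (g : G)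
    (v : Fin d → ℂ) : matrixRep f g v = (f (MonoidAlgebra.of ℂ G g)).mulVec v := by
  simp [matrixRep]

theorem isIrreducible_matrixRep {d : ℕ} [NeZero d] (f : ℂ[G] →ₐ[ℂ] Matrix (Fin d) (Fin d) ℂ)
    (hf : Function.Surjective f) : (matrixRep f).IsIrreducible := by
  have stable (W : Subrepresentation (matrixRep f)) (a : ℂ[G]) (v : Fin d → ℂ)
      (hv : v ∈ W.toSubmodule) : (f a).mulVec v ∈ W.toSubmodule := by
    induction a using MonoidAlgebra.induction_on with
    | of g => rw [← matrixRep_apply]; exact W.apply_mem_toSubmodule g hv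
    | add a b ha hb => rw [map_add, Matrix.add_mulVec]; exact add_mem ha hb
    | smul r a ha => rw [map_smul, Matrix.smul_mulVec]; exact W.toSubmodule.smul_mem r ha
  have top_of_mem (W : Subrepresentation (matrixRep f)) (v : Fin d → ℂ) (hv0 : v ≠ 0)
      (hv : v ∈ W.toSubmodule) : W.toSubmodule = ⊤ := by
    refine eq_top_iff.2 fun w _ => ?_
    obtain ⟨j, hj⟩ := Function.ne_iff.1 hv0
    -- This rank-one matrix sends `v` to `w`.
    obtain ⟨a, ha⟩ := hf (Matrix.vecMulVec w (Pi.single j (v j)⁻¹))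
    have := stable W a v hv
    rw [ha, Matrix.vecMulVec_mulVec] at this
    have hj' : v j ≠ 0 := hj
    simpa [← MulOpposite.op_mul, hj'] using this
  refine { exists_pair_ne := ⟨⊥, ⊤, fun h => ?_⟩, eq_bot_or_eq_top := fun W => ?_ }
  · have h1 : (⊥ : Submodule ℂ (Fin d → ℂ)) = ⊤ := congrArg Subrepresentation.toSubmodule h
    exact bot_ne_top h1
  · by_cases hW : W.toSubmodule = ⊥
    · exact Or.inl (Subrepresentation.toSubmodule_injective hW)
    · obtain ⟨v, hv, hv0⟩ := Submodule.exists_mem_ne_zero_of_ne_bot hW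
      exact Or.inr (Subrepresentation.toSubmodule_injective (top_of_mem W v hv0 hv))

/-- A normal subgroup fixing a nonzero vector of an irreducible representation acts trivially. -/
theorem forall_apply_eq_of_fixed {V : Type*} [AddCommGroup V] [Module ℂ V]
    {ρ : Representation ℂ G V} (hρ : ρ.IsIrreducible) (N : Subgroup G) [N.Normal] {v : V}
    (hv0 : v ≠ 0) (hv : ∀ n ∈ N, ρ n v = v) : ∀ n ∈ N, ρ n = 1 := by
  -- Normality makes the space of `N`-fixed vectors `G`-stable.
  let W : Subrepresentation ρ :=
    { toSubmodule :=
        { carrier := {v | ∀ n ∈ N, ρ n v = v}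
          add_mem' := fun ha hb n hn => by rw [map_add, ha n hn, hb n hn]
          zero_mem' := fun n _ => map_zero _
          smul_mem' := fun c v hv n hn => by rw [map_smul, hv n hn] }
      apply_mem_toSubmodule := fun g v hv n hn => by
        have h := hv _ (‹N.Normal›.conj_mem' n hn g)
        rw [← Module.End.mul_apply, ← map_mul]
        conv_rhs => rw [← h, ← Module.End.mul_apply, ← map_mul]
        congr 2
        group }
  rcases hρ.eq_bot_or_eq_top W with h | h
  · have : v ∈ (⊥ : Submodule ℂ V) :=
      (congrArg Subrepresentation.toSubmodule h).le (show v ∈ W.toSubmodule from hv)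
    exact absurd this hv0
  · intro n hn
    ext w
    have : w ∈ W.toSubmodule :=
      (congrArg Subrepresentation.toSubmodule h).ge (show w ∈ (⊤ : Submodule ℂ V) from trivial)
    exact this n hn

/-- The elements of the group algebra fixed by left multiplication by `N`. -/
def leftFixed (N : Subgroup G) : Submodule ℂ ℂ[G] where
  carrier := {a | ∀ n ∈ N, MonoidAlgebra.of ℂ G n * a = a}
  add_mem' ha hb n hn := by rw [mul_add, ha n hn, hb n hn]
  zero_mem' n _ := mul_zero _
  smul_mem' c a ha n hn := by rw [mul_smul_comm, ha n hn]

theorem mem_leftFixed_iff {N : Subgroup G} {a : ℂ[G]} :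
    a ∈ leftFixed N ↔ ∀ n ∈ N, ∀ g, a.coeff (n * g) = a.coeff g := by
  constructor
  · intro h n hn g
    conv_rhs => rw [← h n⁻¹ (inv_mem hn)]
    simp [MonoidAlgebra.of_apply]
  · intro h n hn
    ext g
    rw [MonoidAlgebra.of_apply, MonoidAlgebra.coeff_single_mul_apply, one_mul]
    exact h _ (inv_mem hn) g

/-- Fixed elements are functions constant on the cosets `Ng`, which equal `gN` by normality. -/
theorem finrank_leftFixed [Finite G] (N : Subgroup G) [N.Normal] :
    Module.finrank ℂ (leftFixed N) = N.index := by
  let e : leftFixed N ≃ₗ[ℂ] (G ⧸ N → ℂ) :=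
    { toFun := fun a x => Quotient.liftOn' x (fun g => (a : ℂ[G]).coeff g) (fun g g' h => by
        have h' := QuotientGroup.leftRel_apply.1 h
        have := mem_leftFixed_iff.1 a.2 _ (‹N.Normal›.conj_mem _ h' g) g
        simpa using this.symm)
      map_add' := fun a b => by ext x; induction x using Quotient.inductionOn'; rfl
      map_smul' := fun c a => by ext x; induction x using Quotient.inductionOn'; rfl
      invFun := fun f => ⟨.ofCoeff (Finsupp.equivFunOnFinite.symm fun g => f g), by
        rw [mem_leftFixed_iff]
        intro n hn g
        have : ((n * g : G) : G ⧸ N) = (g : G ⧸ N) := by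
          rw [QuotientGroup.mk_mul, (QuotientGroup.eq_one_iff n).2 hn, one_mul]
        exact congrArg f this⟩
      left_inv := fun a => by ext g; rfl
      right_inv := fun f => by ext x; induction x using Quotient.inductionOn'; rfl }
  have := Fintype.ofFinite (G ⧸ N)
  rw [e.finrank_eq, Module.finrank_fintype_fun_eq_card, Subgroup.index, Nat.card_eq_fintype_card]

open Classical in
/-- There are irreducible representations of `G` of degrees `dᵢ` such that, for every normal
subgroup `N`, the squares of the degrees of those which are trivial on `N` sum to `|G : N|`. -/
theorem exists_irreducible_family (G : Type*) [Group G] [Finite G] :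
    ∃ (m : ℕ) (d : Fin m → ℕ) (ρ : ∀ i, Representation ℂ G (Fin (d i) → ℂ)),
      (∀ i, (ρ i).IsIrreducible) ∧ ∀ N : Subgroup G, N.Normal →
        ∑ i with ∀ n ∈ N, ρ i n = 1, d i ^ 2 = N.index := by
  obtain ⟨m, d, hd, ⟨φ⟩⟩ := IsSemisimpleRing.exists_algEquiv_pi_matrix_of_isAlgClosed ℂ ℂ[G]
  let f (i : Fin m) : ℂ[G] →ₐ[ℂ] Matrix (Fin (d i)) (Fin (d i)) ℂ :=
    (Pi.evalAlgHom ℂ (fun i => Matrix (Fin (d i)) (Fin (d i)) ℂ) i).comp φ.toAlgHom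
  have hf i : Function.Surjective (f i) := (Function.surjective_eval i).comp φ.surjective
  have hirr i : (matrixRep (f i)).IsIrreducible := isIrreducible_matrixRep (f i) (hf i)
  refine ⟨m, d, fun i => matrixRep (f i), hirr, fun N hN => ?_⟩
  set I : Set (Fin m) := {i | ∀ n ∈ N, matrixRep (f i) n = 1} with hI
  -- The `N`-fixed elements fill exactly the matrix blocks on which `N` acts trivially; comparing
  -- dimensions gives the sum.
  have hmap : (leftFixed N).map φ.toLinearEquiv.toLinearMap =
      ⨅ i ∈ Iᶜ, LinearMap.ker
        (LinearMap.proj i : (Π i, Matrix (Fin (d i)) (Fin (d i)) ℂ) →ₗ[ℂ] _) := by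
    ext x
    obtain ⟨a, rfl⟩ := φ.surjective x
    have h1 : φ a ∈ (leftFixed N).map φ.toLinearEquiv.toLinearMap ↔ a ∈ leftFixed N :=
      ⟨fun ⟨b, hb, hab⟩ => φ.injective hab ▸ hb, fun h => ⟨a, h, rfl⟩⟩
    -- Left multiplication acts on a matrix column by column.
    have h2 : a ∈ leftFixed N ↔
        ∀ i, ∀ n ∈ N, ∀ j, matrixRep (f i) n ((f i a).col j) = (f i a).col j := by
      constructor
      · intro h i n hn j
        rw [matrixRep_apply]
        conv_rhs => rw [← h n hn, map_mul]
        rfl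
      · intro h n hn
        apply φ.injective
        funext i
        rw [map_mul]
        ext k j
        have := congrFun (h i n hn j) k
        rw [matrixRep_apply] at this
        exact this
    rw [h1, h2]
    simp only [Submodule.mem_iInf, LinearMap.mem_ker, LinearMap.proj_apply]
    constructor
    · intro h i hi
      by_contra h0
      obtain ⟨j, hj⟩ : ∃ j, (f i a).col j ≠ 0 := by
        by_contra! hc
        exact h0 (by ext k j; exact congrFun (hc j) k)
      exact hi (forall_apply_eq_of_fixed (hirr i) N hj fun n hn => h i n hn j)
    · intro h i n hn j
      by_cases hi : i ∈ I
      · rw [hi n hn]; rfl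
      · have h0 : f i a = 0 := h i hi
        have : (f i a).col j = 0 := by rw [h0]; rfl
        rw [this, map_zero]
  have e1 := (φ.toLinearEquiv.submoduleMap (leftFixed N)).finrank_eq
  rw [finrank_leftFixed] at e1
  have e2 := (LinearMap.iInfKerProjEquiv ℂ (fun i => Matrix (Fin (d i)) (Fin (d i)) ℂ)
    (disjoint_compl_right (a := I)) (by simp)).finrank_eq
  have e3 : N.index = Module.finrank ℂ (Π i : I, Matrix (Fin (d i)) (Fin (d i)) ℂ) := by
    rw [e1, ← e2]
    exact (LinearEquiv.ofEq _ _ hmap).finrank_eq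
  rw [e3, Module.finrank_pi_fintype]
  simp only [Module.finrank_matrix, Module.finrank_self, Fintype.card_fin, mul_one, ← sq]
  exact Finset.sum_subtype _ (by simp [hI]) _

end Wedderburn

/-! ### Codegrees and the prime divisors of `|N|` -/

section Solvable

variable {G : Type*} [Group G] [Finite G]

theorem mem_charKer {n : ℕ} {ρ : Representation ℂ G (Fin n → ℂ)} (hρ : ρ.IsIrreducible) (g : G) :
    g ∈ charKer ⟨ρ.character, n, ρ, hρ, rfl⟩ ↔ ρ g = 1 :=
  character_eq_iff ρ g

theorem charKer_normal (χ : Irr G) : (charKer χ).Normal := by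
  obtain ⟨_, n, ρ, hρ, rfl⟩ := χ
  refine ⟨fun a ha g => ?_⟩
  rw [mem_charKer hρ] at ha ⊢
  rw [map_mul, map_mul, ha, mul_one, ← map_mul, mul_inv_cancel, map_one]

/-- The hypothesis on codegrees is inherited by quotients. -/
theorem isPrimePower_codegree_of_surjective {H : Type*} [Group H] [Finite H] (π : G →* H)
    (hπ : Function.Surjective π) (h : ∀ χ : Irr G, IsPrimePower (codegree χ)) (χ : Irr H) :
    IsPrimePower (codegree χ) := by
  obtain ⟨_, n, ρ, hρ, rfl⟩ := χ
  let σ : Representation ℂ G (Fin n → ℂ) := ρ.comp π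
  let e : Subrepresentation ρ ≃o Subrepresentation σ :=
    { toFun := fun W => ⟨W.toSubmodule, fun g _ hv => W.apply_mem_toSubmodule (π g) hv⟩
      invFun := fun W => ⟨W.toSubmodule, fun x v hv => by
        obtain ⟨g, rfl⟩ := hπ x
        exact W.apply_mem_toSubmodule g hv⟩
      left_inv := fun _ => rfl
      right_inv := fun _ => rfl
      map_rel_iff' := Iff.rfl }
  have hσ : σ.IsIrreducible := e.symm.isSimpleOrder
  have hker : charKer ⟨σ.character, n, σ, hσ, rfl⟩ =
      (charKer ⟨ρ.character, n, ρ, hρ, rfl⟩).comap π := by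
    ext g
    rw [Subgroup.mem_comap, mem_charKer hρ, mem_charKer hσ]
    rfl
  have := h ⟨σ.character, n, σ, hσ, rfl⟩
  rw [codegree, hker, Subgroup.index_comap_of_surjective _ hπ] at this
  simpa [codegree, Representation.char_one] using this

/-- If the codegrees are prime powers, a nontrivial normal subgroup contained in all other ones
has prime power order. -/
theorem isPGroup_of_forall_normal_le (h : ∀ χ : Irr G, IsPrimePower (codegree χ))
    (N : Subgroup G) [hN : N.Normal] (hmin : ∀ M : Subgroup G, M.Normal → M ≠ ⊥ → N ≤ M) :
    ∃ p, p.Prime ∧ IsPGroup p N := by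
  classical
  obtain ⟨m, d, ρ, hirr, hsum⟩ := exists_irreducible_family G
  have hcard : ∑ i, d i ^ 2 = Nat.card G := by
    simpa using hsum ⊥ inferInstance
  have hsq i : d i ^ 2 ≤ Nat.card G :=
    hcard ▸ Finset.single_le_sum (f := fun i => d i ^ 2) (fun _ _ => Nat.zero_le _)
      (Finset.mem_univ i)
  have hdeg i (hi : ¬ ∀ n ∈ N, ρ i n = 1) :
      ∃ p k, p.Prime ∧ Nat.card G = d i * p ^ k := by
    obtain ⟨p, k, hp, hpk⟩ := h ⟨_, d i, ρ i, hirr i, rfl⟩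
    have hker : charKer ⟨(ρ i).character, d i, ρ i, hirr i, rfl⟩ = ⊥ := by
      by_contra hne
      exact hi fun n hn => (mem_charKer (hirr i) n).1 (hmin _ (charKer_normal _) hne hn)
    refine ⟨p, k, hp, ?_⟩
    -- With `d i = 0`, division by zero would make the codegree `0`, which is not a prime power.
    have hd0 : (d i : ℂ) ≠ 0 := by
      intro h0
      simp [codegree, Representation.char_one, h0] at hpk
      exact pow_ne_zero k (Nat.cast_ne_zero.2 hp.ne_zero) hpk.symm
    rw [codegree, hker, Subgroup.index_bot] at hpk
    simp only [Representation.char_one, Module.finrank_fintype_fun_eq_card, Fintype.card_fin]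
      at hpk
    rw [div_eq_iff hd0] at hpk
    rw [mul_comm]
    exact_mod_cast hpk
  have hmul : N.index * Nat.card N = Nat.card G := N.index_mul_card
  have hN0 : 0 < Nat.card N := Nat.card_pos
  have hG0 : 0 < Nat.card G := Nat.card_pos
  -- Otherwise the full `q`-part of `|G|` divides every degree nontrivial on `N`, hence `|G : N|
  -- (|N| - 1)`. As `q` is coprime to `|N| - 1`, it divides `|G : N|`, although `q` divides `|N|`.
  have key q (hq : q.Prime) (hqN : q ∣ Nat.card N) : ∃ i k, Nat.card G = d i * q ^ k := by
    by_contra! hno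
    set v := (Nat.card G).factorization q
    have hdvd i (hi : ¬ ∀ n ∈ N, ρ i n = 1) : q ^ v ∣ d i := by
      obtain ⟨p, k, hp, hpk⟩ := hdeg i hi
      have hpq : q ≠ p := by rintro rfl; exact hno i k hpk
      refine (Nat.Coprime.pow v k ((Nat.coprime_primes hq hp).2 hpq)).dvd_of_dvd_mul_right ?_
      exact hpk ▸ Nat.ordProj_dvd _ _
    have hsplit := Finset.sum_filter_add_sum_filter_not Finset.univ
      (fun i => ∀ n ∈ N, ρ i n = 1) (fun i => d i ^ 2)
    rw [hsum N hN, hcard, ← hmul] at hsplit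
    have h1 : q ^ v ∣ ∑ i with ¬ ∀ n ∈ N, ρ i n = 1, d i ^ 2 :=
      Finset.dvd_sum fun i hi => dvd_pow (hdvd i (Finset.mem_filter.1 hi).2) two_ne_zero
    have h2 : ∑ i with ¬ ∀ n ∈ N, ρ i n = 1, d i ^ 2 = N.index * (Nat.card N - 1) := by
      rw [Nat.mul_sub, mul_one]; omega
    rw [h2] at h1
    have hcop : Nat.Coprime q (Nat.card N - 1) := by
      refine (Nat.Prime.coprime_iff_not_dvd hq).2 fun hd => ?_
      have := (Nat.dvd_sub_iff_right hN0 hqN).1 hd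
      exact hq.one_lt.ne' (Nat.dvd_one.1 this)
    have h3 : q ^ v ∣ N.index := (Nat.Coprime.pow_left v hcop).dvd_of_dvd_mul_right h1
    have h4 : q ^ (v + 1) ∣ Nat.card G := by
      rw [pow_succ, ← hmul]; exact mul_dvd_mul h3 hqN
    exact Nat.pow_succ_factorization_not_dvd hG0.ne' hq h4
  have huniq p q (hp : p.Prime) (hq : q.Prime) (hpN : p ∣ Nat.card N) (hqN : q ∣ Nat.card N) :
      p = q := by
    by_contra hne
    obtain ⟨i, k, hk⟩ := key p hp hpN
    obtain ⟨j, l, hl⟩ := key q hq hqN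
    have hcop : Nat.Coprime (p ^ k) (q ^ l) :=
      Nat.Coprime.pow k l ((Nat.coprime_primes hp hq).2 hne)
    have hle : p ^ k * q ^ l ≤ Nat.card G := Nat.le_of_dvd hG0
      (hcop.mul_dvd_of_dvd_of_dvd (Dvd.intro_left _ hk.symm) (Dvd.intro_left _ hl.symm))
    have h1 : d i ≤ p ^ k := by
      have := hsq i
      rw [hk, sq] at this
      exact Nat.le_of_mul_le_mul_left this (Nat.pos_of_mul_pos_right (hk ▸ hG0))
    have h2 : d j ≤ q ^ l := by
      have := hsq j
      rw [hl, sq] at this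
      exact Nat.le_of_mul_le_mul_left this (Nat.pos_of_mul_pos_right (hl ▸ hG0))
    have h3 : q ^ l ≤ d i := by
      rw [hk, mul_comm] at hle
      exact Nat.le_of_mul_le_mul_right hle (pow_pos hp.pos k)
    have h4 : p ^ k ≤ d j := by
      rw [hl] at hle
      exact Nat.le_of_mul_le_mul_right hle (pow_pos hq.pos l)
    -- The bounds form a cycle `q ^ l ≤ d i ≤ p ^ k ≤ d j ≤ q ^ l`; equal coprime powers are `1`,
    -- which forces `|G| = 1`.
    have h5 : p ^ k = q ^ l := by omega
    have h6 : d i = 1 ∧ p ^ k = 1 := by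
      have h7 : p ^ k = 1 := by
        rw [← h5] at hcop
        exact (Nat.coprime_self _).1 hcop
      exact ⟨by omega, h7⟩
    rw [h6.1, h6.2] at hk
    have := (Nat.dvd_trans hpN (Dvd.intro_left _ hmul))
    rw [hk] at this
    exact hp.one_lt.ne' (Nat.dvd_one.1 this)
  by_cases h1 : Nat.card N = 1
  · exact ⟨2, Nat.prime_two, IsPGroup.of_card (n := 0) (by simpa using h1)⟩
  · have hp := Nat.minFac_prime h1
    exact ⟨_, hp, IsPGroup.of_card (Nat.eq_prime_pow_of_unique_prime_dvd hN0.ne' fun hq hqN =>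
      huniq _ _ hq hp hqN (Nat.minFac_dvd _))⟩

end Solvable

/-! ### The solvable residual -/

section Residual

/-- A finite group has a normal subgroup contained in every normal subgroup with solvable
quotient, and trivial only if the group is solvable. -/
theorem exists_normal_le_of_isSolvable_quotient (G : Type*) [Group G] [Finite G] :
    ∃ N : Subgroup G, N.Normal ∧ (N = ⊥ → Group.IsSolvable G) ∧
      ∀ M : Subgroup G, ∀ _ : M.Normal, Group.IsSolvable (G ⧸ M) → N ≤ M := by
  -- The residual is the stable term of the derived series.
  obtain ⟨n, hn⟩ : ∃ n, ∀ m, n ≤ m → derivedSeries G n = derivedSeries G m :=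
    WellFoundedGT.monotone_chain_condition
      ⟨fun n => OrderDual.toDual (derivedSeries G n), derivedSeries_antitone G⟩
  refine ⟨derivedSeries G n, inferInstance, fun h => ⟨n, h⟩, fun M hM ⟨m, hm⟩ => ?_⟩
  have h1 : (derivedSeries G m).map (QuotientGroup.mk' M) = ⊥ := by
    rw [map_derivedSeries_eq (QuotientGroup.mk'_surjective M), hm]
  rw [Subgroup.map_eq_bot_iff, QuotientGroup.ker_mk'] at h1
  rw [hn _ (le_max_left n m)]
  exact (derivedSeries_antitone G (le_max_right n m)).trans h1

end Residual

end CharCodegree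

open CharCodegree in
theorem isSolvable_of_card_eq (c : ℕ) : ∀ {G : Type*} [Group G] [Finite G], Nat.card G = c →
    (∀ χ : Irr G, IsPrimePower (codegree χ)) → Group.IsSolvable G := by
  induction c using Nat.strong_induction_on with
  | _ c ih =>
    intro G _ _ hc h
    obtain ⟨N, hN, hbot, hle⟩ := exists_normal_le_of_isSolvable_quotient G
    have hquot (M : Subgroup G) (hM : M.Normal) (hne : M ≠ ⊥) : Group.IsSolvable (G ⧸ M) := by
      refine ih (Nat.card (G ⧸ M)) ?_ rfl
        (isPrimePower_codegree_of_surjective _ (QuotientGroup.mk'_surjective M) h)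
      rw [← hc, Subgroup.card_eq_card_quotient_mul_card_subgroup M]
      exact lt_mul_of_one_lt_right Nat.card_pos (M.one_lt_card_iff_ne_bot.2 hne)
    by_cases h0 : N = ⊥
    · exact hbot h0
    obtain ⟨p, hp, hpN⟩ := isPGroup_of_forall_normal_le h N
      fun M hM hne => hle M hM (hquot M hM hne)
    have := Fact.mk hp
    have := hpN.isNilpotent
    have := hquot N hN h0
    exact Group.isSolvable_of_ker_le_range N.subtype (QuotientGroup.mk' N) (by simp)

theorem mainTheorem5 {G : Type*} [Group G] [Finite G]
    (h : ∀ χ : CharCodegree.Irr G, CharCodegree.IsPrimePower (CharCodegree.codegree χ)) :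
    Group.IsSolvable G :=
  isSolvable_of_card_eq _ rfl h
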